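/- Let $\beta>1$ be a simple Parry number, that is, the Rényi expansion $d_\beta(1)=t_1t_2t_3\cdots$, where $t_i=\lfloor \beta T_\beta^{i-1}(1)\rfloor$ and $T_\beta(x)=\beta x-\lfloor \beta x\rfloor$, has only finitely many non-zero digits; write $d_\beta(1)=t_1\cdots t_m$ with $t_m\neq 0$. Assume that $t_1=t_2=\cdots=t_{m-1}$ (no condition if $m=1$). Let $u_\beta=\lim_{n\to\infty}\varphi^n(0)$ be the right infinite fixed point of the substitution $\varphi$ on the alphabet $\mathcal A=\{0,1,\dots,m-1\}$ given by $\varphi(k)=0^{t_{k+1}}(k+1)$ for $0\le k\le m-2$ and $\varphi(m-1)=0^{t_m}$. For a center $c\in\mathcal A\cup\{\varepsilon\}$ (a letter or the empty word), an infinite palindromic branch of $u_\beta$ with center $c$ is a two-sided infinite word $\cdots v_3v_2v_1\,c\,v_1v_2v_3\cdots$ with letters $v_i\in\mathcal A$ such that for every $n\ge 1$ the palindrome $v_n\cdots v_1\,c\,v_1\cdots v_n$ is a factor of $u_\beta$. Then for each $c\in\mathcal A\cup\{\varepsilon\}$ the word $u_\beta$ has at most one infinite palindromic branch with center $c$. 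-/

import Mathlib

namespace ParryWord

/-- The transformation `x ↦ β x - ⌊β x⌋`. -/
noncomputable def T (β x : ℝ) : ℝ := β * x - ⌊β * x⌋

/-- The digits of the Rényi expansion of `1` in base `β`, indexed from `0`:
`digit β i` is `t_{i+1} = ⌊β T^i(1)⌋`. -/
noncomputable def digit (β : ℝ) (i : ℕ) : ℕ := ⌊β * (T β)^[i] 1⌋₊

/-- `β` is a simple Parry number and `d_β(1) = t_1 ⋯ t_m` with `t_m ≠ 0`. -/
structure IsSimpleParry (β : ℝ) (m : ℕ) : Prop where
  one_lt : 1 < β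
  pos : 0 < m
  last_ne_zero : digit β (m - 1) ≠ 0
  eq_zero : ∀ i, m ≤ i → digit β i = 0

/-- Condition (C): `t_1 = t_2 = ⋯ = t_{m-1}`. -/
def ConditionC (β : ℝ) (m : ℕ) : Prop := ∀ i, i + 1 < m → digit β i = digit β 0

/-- The canonical substitution on letters, over the alphabet `{0, …, m-1}`:
`k ↦ 0^{t_{k+1}} (k+1)` for `k < m - 1`, and `m - 1 ↦ 0^{t_m}`. -/
noncomputable def substLetter (β : ℝ) (m : ℕ) [NeZero m] (k : Fin m) : List (Fin m) :=
  List.replicate (digit β k) 0 ++ (if h : (k : ℕ) + 1 < m then [⟨(k : ℕ) + 1, h⟩] else [])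

/-- The canonical substitution as a morphism of the free monoid of finite words. -/
noncomputable def subst (β : ℝ) (m : ℕ) [NeZero m] (w : List (Fin m)) : List (Fin m) :=
  w.flatMap (substLetter β m)

/-- The right infinite word `u_β = lim φ^n(0)`; its letter at position `k` is read off from
`φ^k(0)`, which has more than `k` letters. See `uWord_spec`. -/
noncomputable def uWord (β : ℝ) (m : ℕ) [NeZero m] (k : ℕ) : Fin m :=
  ((subst β m)^[k] [0]).getD k 0

/-- The language of a right infinite word: the set of its (finite) factors. -/
def language {A : Type*} (u : ℕ → A) : Set (List A) :=
  {w | ∃ i, w = (List.range w.length).map fun j => u (i + j)}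

/-- The palindromes occurring in a right infinite word. -/
def pal {A : Type*} (u : ℕ → A) : Set (List A) :=
  {w | w ∈ language u ∧ w.reverse = w}

/-- The finite word `v_n ⋯ v_1 c v_1 ⋯ v_n`, where `v_{j+1}` is `v j` and the center `c` is a letter
(`some a`) or the empty word (`none`). -/
def centralWord {A : Type*} (c : Option A) (v : ℕ → A) (n : ℕ) : List A :=
  ((List.range n).map v).reverse ++ c.toList ++ (List.range n).map v

/-- The two-sided infinite word `⋯ v_2 v_1 c v_1 v_2 ⋯`. If `c` is a letter it stands at position
`0`; if `c` is empty, the two copies of `v_1` stand at positions `-1` and `0`. -/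
def twoSided {A : Type*} : Option A → (ℕ → A) → ℤ → A
  | some a, v => fun k => if k = 0 then a else v (k.natAbs - 1)
  | none, v => fun k => if 0 ≤ k then v k.natAbs else v (k.natAbs - 1)

/-- `x` is an infinite palindromic branch of `u` with center `c`. -/
def IsInfinitePalindromicBranch {A : Type*} (u : ℕ → A) (c : Option A) (x : ℤ → A) : Prop :=
  ∃ v : ℕ → A, x = twoSided c v ∧ ∀ n, 1 ≤ n → centralWord c v n ∈ pal u

section Limit

theorem digit_zero_pos {β : ℝ} (h : 1 < β) : 1 ≤ digit β 0 := by
  simp only [digit, Function.iterate_zero, id, mul_one]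
  exact Nat.le_floor (by simpa using h.le)

theorem T_one_of_length_one {β : ℝ} (h : IsSimpleParry β 1) : T β 1 = 0 := by
  have hb := h.one_lt
  have h0 : 0 ≤ T β 1 := by simp only [T]; linarith [Int.floor_le (β * 1)]
  have key : ∀ j : ℕ, (T β)^[j + 1] 1 = β ^ j * T β 1 := by
    intro j
    induction j with
    | zero => simp
    | succ j ih =>
      have hd := h.eq_zero (j + 1) (by omega)
      have hlt : β * (T β)^[j + 1] 1 < 1 := by
        simpa [digit, Nat.floor_eq_zero] using hd
      have hnn : 0 ≤ β * (T β)^[j + 1] 1 := by rw [ih]; positivity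
      have hf : ⌊β * (T β)^[j + 1] 1⌋ = 0 := Int.floor_eq_zero_iff.2 ⟨hnn, hlt⟩
      rw [Function.iterate_succ_apply', T, hf, ih]
      push_cast
      ring
  have hlt : ∀ j : ℕ, β ^ j * T β 1 < 1 := by
    intro j
    rw [← key j, Function.iterate_succ_apply', T]
    linarith [Int.lt_floor_add_one (β * (T β)^[j] 1)]
  by_contra hne
  have hpos : 0 < T β 1 := lt_of_le_of_ne h0 (Ne.symm hne)
  obtain ⟨j, hj⟩ := pow_unbounded_of_one_lt (1 / T β 1) hb
  have h1 := hlt j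
  rw [div_lt_iff₀ hpos] at hj
  linarith

theorem two_le_digit_of_length_one {β : ℝ} (h : IsSimpleParry β 1) : 2 ≤ digit β 0 := by
  have hT := T_one_of_length_one h
  have hb := h.one_lt
  simp only [T, mul_one] at hT
  have h1 : (1 : ℤ) < ⌊β⌋ := by
    have : (1 : ℝ) < (⌊β⌋ : ℝ) := by linarith
    exact_mod_cast this
  have h2 : (2 : ℝ) ≤ β := by
    have : ((2 : ℤ) : ℝ) ≤ (⌊β⌋ : ℝ) := by exact_mod_cast h1
    push_cast at this
    linarith
  simp only [digit, Function.iterate_zero, id, mul_one]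
  exact Nat.le_floor (by simpa using h2)

variable {β : ℝ} {m : ℕ} [NeZero m]

theorem subst_append (v w : List (Fin m)) :
    subst β m (v ++ w) = subst β m v ++ subst β m w := by
  simp [subst]

theorem iterate_subst_append (n : ℕ) (v w : List (Fin m)) :
    (subst β m)^[n] (v ++ w) = (subst β m)^[n] v ++ (subst β m)^[n] w := by
  induction n generalizing v w with
  | zero => rfl
  | succ n ih => simp only [Function.iterate_succ_apply, subst_append, ih]

theorem substLetter_ne_nil (h : IsSimpleParry β m) (k : Fin m) : substLetter β m k ≠ [] := by
  by_cases hk : (k : ℕ) + 1 < m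
  · simp [substLetter, hk]
  · have : (k : ℕ) = m - 1 := by have := k.2; omega
    simp [substLetter, this, h.last_ne_zero]

theorem iterate_subst_ne_nil (h : IsSimpleParry β m) (n : ℕ) (w : List (Fin m)) (hw : w ≠ []) :
    (subst β m)^[n] w ≠ [] := by
  induction n generalizing w with
  | zero => exact hw
  | succ n ih =>
    rw [Function.iterate_succ_apply]
    refine ih _ ?_
    cases w with
    | nil => exact absurd rfl hw
    | cons a w => simp [subst, substLetter_ne_nil h a]

theorem subst_zero (h : IsSimpleParry β m) : ∃ w, w ≠ [] ∧ subst β m [0] = [0] ++ w := by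
  have h1 := digit_zero_pos h.one_lt
  obtain ⟨d, hd⟩ : ∃ d, digit β 0 = d + 1 := ⟨digit β 0 - 1, by omega⟩
  by_cases hm : 1 < m
  · exact ⟨List.replicate d 0 ++ [⟨1, hm⟩], by simp,
      by simp [subst, substLetter, hd, hm, List.replicate_succ]⟩
  · have hm1 : m = 1 := by have := h.pos; omega
    subst hm1
    have h2 := two_le_digit_of_length_one h
    refine ⟨List.replicate d 0, ?_, by simp [subst, substLetter, hd, List.replicate_succ]⟩
    have : d ≠ 0 := by omega
    simpa using this

theorem iterate_subst_succ (h : IsSimpleParry β m) (n : ℕ) :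
    ∃ w, w ≠ [] ∧ (subst β m)^[n + 1] [0] = (subst β m)^[n] [0] ++ w := by
  obtain ⟨w, hw, he⟩ := subst_zero h
  exact ⟨_, iterate_subst_ne_nil h n w hw,
    by rw [Function.iterate_succ_apply, he, iterate_subst_append]⟩

theorem lt_length_iterate (h : IsSimpleParry β m) (n : ℕ) :
    n < ((subst β m)^[n] [0]).length := by
  induction n with
  | zero => simp
  | succ n ih =>
    obtain ⟨w, hw, he⟩ := iterate_subst_succ h n
    have := List.length_pos_iff.2 hw
    rw [he, List.length_append]
    omega

/-- `uWord β m` is the limit of the words `φ^n(0)`: the letter of `φ^n(0)` at position `k` exists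
and equals the letter of `uWord β m` for all `n ≥ k`. -/
theorem uWord_spec (h : IsSimpleParry β m) (k n : ℕ) (hkn : k ≤ n) :
    ((subst β m)^[n] [0])[k]? = some (uWord β m k) := by
  induction n, hkn using Nat.le_induction with
  | base =>
    have := lt_length_iterate h k
    simp [uWord, this]
  | succ n hn ih =>
    obtain ⟨w, -, he⟩ := iterate_subst_succ h n
    have := lt_length_iterate h n
    rw [he, List.getElem?_append_left (by omega), ih]

end Limit

end ParryWord

namespace ParryWord

/-! Write φ for the substitution, t = t_1 and s = t_m. Under condition (C), φ(k)0^t = 0^t ψ(k),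
where ψ(k) is the mirror image of φ(k). As φ is injective on words, φ(w)0^t is a palindrome exactly
when w is one. A non-zero letter always ends its block, so a palindrome flanked by such a letter has
the form φ(q)0^t with q a palindromic factor (`exists_desubstitution`). Runs of zeros are bounded,
so long palindromes come from long ones.

The finitely many centers of arbitrarily long palindromes are mapped onto themselves by
`nextCenter`, hence injectively: long palindromes with the same center have preimages with the same
center. Induction on n then shows that long palindromes with the same center agree on the n letters
next to it (`exists_agree`): the image of a right half starts with a common run of zeros, so fewer
letters of the preimages are needed. Only the empty center with t = 1 has no such zeros, and it is
handled by one further desubstitution. For m = 1 there is only one letter. -/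

/-- The image of a letter under `k ↦ 0^t (k+1)` for `k < m - 1`, `m - 1 ↦ 0^s`. -/
def img {m : ℕ} [NeZero m] (t s : ℕ) (k : Fin m) : List (Fin m) :=
  if h : (k : ℕ) + 1 < m then List.replicate t 0 ++ [⟨(k : ℕ) + 1, h⟩] else List.replicate s 0

/-- The conjugate substitution `k ↦ (k+1) 0^t` for `k < m - 1`, `m - 1 ↦ 0^s`. -/
def conjImg {m : ℕ} [NeZero m] (t s : ℕ) (k : Fin m) : List (Fin m) :=
  if h : (k : ℕ) + 1 < m then ⟨(k : ℕ) + 1, h⟩ :: List.replicate t 0 else List.replicate s 0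

/-- The palindrome with center `c` and right half `r`. -/
def palOf {A : Type*} (c : Option A) (r : List A) : List A := r.reverse ++ c.toList ++ r

/-- The finite words occurring in the iterated images of the letter `0`. -/
def factors (m : ℕ) [NeZero m] (t s : ℕ) : Set (List (Fin m)) :=
  {z | ∃ n, z <:+: (fun w : List (Fin m) => w.flatMap (img t s))^[n] [0]}

/-- The center of the image of a palindrome with center `c`. -/
def nextCenter {m : ℕ} [NeZero m] (t s : ℕ) : Option (Fin m) → Option (Fin m)
  | none => if t % 2 = 0 then none else some 0
  | some k => if h : (k : ℕ) + 1 < m then some ⟨(k : ℕ) + 1, h⟩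
      else if (t + s) % 2 = 0 then none else some 0

/-- The number of zeros next to the center of the image of a palindrome with center `c`. -/
def zeroRun {m : ℕ} (t s : ℕ) : Option (Fin m) → ℕ
  | none => t / 2
  | some k => if (k : ℕ) + 1 < m then t else (t + s) / 2

/-! ### Palindromes and runs in concatenations of blocks. -/

section Lists

theorem palOf_injective {A : Type*} {c d : Option A} {r q : List A} (h : palOf c r = palOf d q) :
    c = d ∧ r = q := by
  have hl := congrArg List.length h
  have hr : r.length = q.length := by
    cases c <;> cases d <;> simp [palOf] at hl <;> omega
  have hc : c.toList.length = d.toList.length := by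
    simp only [palOf, List.length_append, List.length_reverse] at hl
    omega
  obtain ⟨h1, h2⟩ := List.append_inj' h hr
  obtain ⟨-, h3⟩ := List.append_inj' h1 hc
  refine ⟨?_, h2⟩
  cases c <;> cases d <;> simp_all

theorem reverse_palOf {A : Type*} (c : Option A) (r : List A) :
    (palOf c r).reverse = palOf c r := by
  cases c <;> simp [palOf]

theorem exists_palOf {A : Type*} (q : List A) (h : q.reverse = q) : ∃ c r, q = palOf c r := by
  have hp := List.Palindrome.of_reverse_eq h
  induction hp with
  | nil => exact ⟨none, [], rfl⟩
  | singleton x => exact ⟨some x, [], rfl⟩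
  | @cons_concat x l hl ih =>
    obtain ⟨c, r, rfl⟩ := ih hl.reverse_eq
    exact ⟨c, r ++ [x], by simp [palOf]⟩

/-- A run of letters not satisfying `P` is short in a concatenation of short words each of which
contains a letter satisfying `P`. -/
theorem length_le_of_flatMap {A B : Type*} (P : B → Prop) (f : A → List B) (K : ℕ)
    (hK : ∀ a, (f a).length ≤ K) (hP : ∀ a, ∃ b ∈ f a, P b) (l : List A) (x z y : List B)
    (hz : ∀ b ∈ z, ¬ P b) (h : x ++ z ++ y = l.flatMap f) : z.length ≤ 2 * K := by
  have prefix_case : ∀ (l : List A) (z y : List B), (∀ b ∈ z, ¬ P b) → z ++ y = l.flatMap f →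
      z.length ≤ K := by
    intro l z y hz h
    cases l with
    | nil => simp at h; simp [h.1]
    | cons a l =>
      rw [List.flatMap_cons, List.append_eq_append_iff] at h
      have := hK a
      rcases h with ⟨w, hw, -⟩ | ⟨w, hw, -⟩
      · rw [hw, List.length_append] at this
        omega
      · obtain ⟨b, hb, hPb⟩ := hP a
        exact absurd hPb (hz b (by rw [hw]; simp [hb]))
  induction l generalizing x with
  | nil => simp at h; simp [h.2.1]
  | cons a l ih =>
    rw [List.flatMap_cons, List.append_assoc, List.append_eq_append_iff] at h
    have := hK a
    rcases h with ⟨w, hw, hw'⟩ | ⟨w, -, hw'⟩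
    -- The run starts inside the block of `a`: it ends there, or goes on into the next block without
    -- passing it.
    · rw [List.append_eq_append_iff] at hw'
      rw [hw, List.length_append] at this
      rcases hw' with ⟨w2, rfl, -⟩ | ⟨w2, rfl, h2⟩
      · simp only [List.length_append] at this
        omega
      · have := prefix_case l w2 y (fun b hb => hz b (by simp [hb])) h2.symm
        simp only [List.length_append]
        omega
    · exact ih w (by rw [hw', List.append_assoc])

end Lists

theorem zeroRun_some_pos {m t s : ℕ} (ht : 0 < t) (hs : 0 < s) (k : Fin m) :
    0 < zeroRun t s (some k) := by
  simp only [zeroRun]; split <;> omega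

/-! ### The substitution, its conjugate, and images of palindromes. -/

section Substitution

variable {m : ℕ} [NeZero m] {t s : ℕ}

theorem length_img_le (k : Fin m) : (img t s k).length ≤ t + s + 1 := by
  unfold img; split <;> simp; omega

theorem length_conjImg_le (k : Fin m) : (conjImg t s k).length ≤ t + s + 1 := by
  unfold conjImg; split <;> simp; omega

theorem le_length_conjImg (hs : 0 < s) (k : Fin m) : 1 ≤ (conjImg t s k).length := by
  unfold conjImg; split <;> simp; omega

theorem length_flatMap_conjImg_le (l : List (Fin m)) :
    (l.flatMap (conjImg t s)).length ≤ (t + s + 1) * l.length := by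
  induction l with
  | nil => simp
  | cons a l ih =>
    have := length_conjImg_le (t := t) (s := s) a
    simp only [List.flatMap_cons, List.length_append, List.length_cons]
    linarith

theorem length_le_flatMap_conjImg (hs : 0 < s) (l : List (Fin m)) :
    l.length ≤ (l.flatMap (conjImg t s)).length := by
  induction l with
  | nil => simp
  | cons a l ih =>
    have := le_length_conjImg (t := t) hs a
    simp only [List.flatMap_cons, List.length_append, List.length_cons]
    omega

theorem img_append_replicate (k : Fin m) :
    img t s k ++ List.replicate t 0 = List.replicate t 0 ++ conjImg t s k := by
  unfold img conjImg
  split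
  · simp
  · simp [add_comm]

theorem flatMap_img_append_replicate (l : List (Fin m)) :
    l.flatMap (img t s) ++ List.replicate t 0 =
      List.replicate t 0 ++ l.flatMap (conjImg t s) := by
  induction l with
  | nil => simp
  | cons a l ih =>
    rw [List.flatMap_cons, List.append_assoc, ih, ← List.append_assoc, img_append_replicate,
      List.append_assoc, List.flatMap_cons]

theorem reverse_flatMap_conjImg (l : List (Fin m)) :
    (l.flatMap (conjImg t s)).reverse = l.reverse.flatMap (img t s) := by
  induction l with
  | nil => simp
  | cons a l ih =>
    have : (conjImg t s a).reverse = img t s a := by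
      unfold img conjImg; split <;> simp
    simp [ih, this]

theorem reverse_flatMap_img_append (l : List (Fin m)) :
    (l.flatMap (img t s) ++ List.replicate t 0).reverse =
      l.reverse.flatMap (img t s) ++ List.replicate t 0 := by
  rw [flatMap_img_append_replicate, List.reverse_append, reverse_flatMap_conjImg,
    List.reverse_replicate]

/-- Words ending in a non-zero letter cut an image at the boundary of a block. -/
theorem exists_split (l : List (Fin m)) (x y : List (Fin m)) (a : Fin m) (ha : a ≠ 0)
    (h : l.flatMap (img t s) = x ++ [a] ++ y) :
    ∃ l₁ l₂, l = l₁ ++ l₂ ∧ l₁.flatMap (img t s) = x ++ [a] ∧ l₂.flatMap (img t s) = y := by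
  induction l generalizing x with
  | nil => simp at h
  | cons k l ih =>
    rw [List.flatMap_cons, List.append_assoc, List.append_eq_append_iff] at h
    rcases h with ⟨w, rfl, hw⟩ | ⟨w, hw, hw'⟩
    · obtain ⟨l₁, l₂, rfl, h1, h2⟩ := ih w (by rw [hw, List.append_assoc])
      exact ⟨k :: l₁, l₂, rfl, by simp [h1], h2⟩
    · cases w with
      | nil =>
        obtain ⟨l₁, l₂, rfl, h1, h2⟩ := ih [] (by simpa using hw'.symm)
        exact ⟨k :: l₁, l₂, rfl, by simpa [h1] using hw, h2⟩
      | cons b w =>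
        simp only [List.cons_append, List.nil_append, List.cons.injEq] at hw'
        obtain ⟨rfl, hy⟩ := hw'
        have hw0 : w = [] := by
          unfold img at hw
          split at hw
          · rcases List.eq_nil_or_concat w with rfl | ⟨w', e, rfl⟩
            · rfl
            · exfalso
              have h1 : List.replicate t 0 ++ [(⟨(k : ℕ) + 1, by assumption⟩ : Fin m)] =
                  (x ++ a :: w') ++ [e] := by simpa using hw
              have h2 := (List.append_inj' h1 rfl).1
              exact ha (List.eq_of_mem_replicate (n := t) (by rw [h2]; simp))
          · exact absurd (List.eq_of_mem_replicate (n := s) (by rw [hw]; simp)) ha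
        subst hw0
        exact ⟨[k], l, rfl, by simpa using hw, by simpa using hy.symm⟩

/-- The last letter of a block determines the block (0 occurs only for `m - 1`), so a word is
decoded from the right. -/
theorem flatMap_img_injective (hs : 0 < s) :
    Function.Injective fun l : List (Fin m) => l.flatMap (img t s) := by
  have hne : ∀ k : Fin m, img t s k ≠ [] := by
    intro k; unfold img; split <;> simp; omega
  intro l
  induction l using List.reverseRecOn with
  | nil =>
    intro l' h
    cases l' with
    | nil => rfl
    | cons a l' => simp [hne] at h
  | append_singleton l a ih =>
    intro l' h
    rcases List.eq_nil_or_concat' l' with rfl | ⟨l', b, rfl⟩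
    · simp [hne] at h
    · simp only [List.flatMap_append, List.flatMap_cons, List.flatMap_nil,
        List.append_nil] at h
      have hlast := congrArg List.getLast? h
      obtain ⟨s, rfl⟩ : ∃ r, s = r + 1 := ⟨s - 1, by omega⟩
      have hab : a = b := by
        by_cases h1 : (a : ℕ) + 1 < m <;> by_cases h2 : (b : ℕ) + 1 < m
        · simp [img, h1, h2] at hlast
          exact Fin.ext hlast
        · rw [img, dif_pos h1, img, dif_neg h2, List.replicate_succ', ← List.append_assoc,
            ← List.append_assoc, List.getLast?_concat, List.getLast?_concat] at hlast
          simpa using congrArg Fin.val (Option.some.inj hlast)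
        · rw [img, dif_neg h1, img, dif_pos h2, List.replicate_succ', ← List.append_assoc,
            ← List.append_assoc, List.getLast?_concat, List.getLast?_concat] at hlast
          simpa using congrArg Fin.val (Option.some.inj hlast)
        · exact Fin.ext (by omega)
      subst hab
      rw [ih (List.append_cancel_right h)]

theorem palOf_image (c : Option (Fin m)) (r : List (Fin m)) :
    (palOf c r).flatMap (img t s) ++ List.replicate t 0 =
      palOf (nextCenter t s c) (List.replicate (zeroRun t s c) 0 ++ r.flatMap (conjImg t s)) := by
  have key : c.toList.flatMap (img t s) ++ List.replicate t 0 =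
      palOf (nextCenter t s c) (List.replicate (zeroRun t s c) 0) := by
    have zeros : ∀ n : ℕ, List.replicate n (0 : Fin m) =
        palOf (if n % 2 = 0 then none else some 0) (List.replicate (n / 2) 0) := by
      intro n
      have h1 : ∀ j, [(0 : Fin m)] ++ List.replicate j 0 = List.replicate (j + 1) 0 :=
        fun j => rfl
      split <;> simp only [palOf, Option.toList, List.reverse_replicate, List.append_nil,
        List.append_assoc, h1, ← List.replicate_add] <;> congr 1 <;> omega
    cases c with
    | none => simpa [nextCenter, zeroRun] using zeros t
    | some k =>
      by_cases hk : (k : ℕ) + 1 < m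
      · simp [nextCenter, zeroRun, hk, img, palOf]
      · simpa [nextCenter, zeroRun, hk, img, ← List.replicate_add, add_comm] using zeros (t + s)
  have : (palOf c r).flatMap (img t s) ++ List.replicate t 0 = r.reverse.flatMap (img t s) ++
      (c.toList.flatMap (img t s) ++ List.replicate t 0) ++ r.flatMap (conjImg t s) := by
    rw [palOf, List.flatMap_append, List.flatMap_append, List.append_assoc,
      flatMap_img_append_replicate]
    simp only [List.append_assoc]
  rw [this, key, ← reverse_flatMap_conjImg]
  simp [palOf]

end Substitution

/-! ### Desubstitution of palindromic factors. -/

section Factors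

variable {m : ℕ} [NeZero m] {t s : ℕ}

theorem factors_of_infix {x y : List (Fin m)} (h : x <:+: y) (hy : y ∈ factors m t s) :
    x ∈ factors m t s := by
  obtain ⟨n, hn⟩ := hy
  exact ⟨n, h.trans hn⟩

theorem exists_infix_flatMap (ht : 0 < t) (hm : 1 < m) {z : List (Fin m)}
    (hz : z ∈ factors m t s) : ∃ l ∈ factors m t s, z <:+: l.flatMap (img t s) := by
  obtain ⟨n, hn⟩ := hz
  cases n with
  | zero =>
    refine ⟨[0], ⟨0, List.infix_rfl⟩, hn.trans ?_⟩
    obtain ⟨t, rfl⟩ : ∃ r, t = r + 1 := ⟨t - 1, by omega⟩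
    exact ⟨[], List.replicate t 0 ++ [⟨1, hm⟩], by simp [img, hm, List.replicate_succ]⟩
  | succ n =>
    rw [Function.iterate_succ_apply'] at hn
    exact ⟨_, ⟨n, List.infix_rfl⟩, hn⟩

/-- Every φ(k) contains 0 and φ(0) contains 1, so every block φ²(k) contains a non-zero letter. -/
theorem exists_zero_bound (m t s : ℕ) [NeZero m] (ht : 0 < t) (hs : 0 < s) (hm : 1 < m) :
    ∃ K, ∀ z ∈ factors m t s, K < z.length → ∃ a ∈ z, a ≠ 0 := by
  have h0 : ∀ k : Fin m, (0 : Fin m) ∈ img t s k := by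
    intro k; unfold img; split <;> simp <;> omega
  have h1 : (⟨1, hm⟩ : Fin m) ∈ img t s (0 : Fin m) := by simp [img, hm]
  have hlen : ∀ l : List (Fin m), (l.flatMap (img t s)).length ≤ (t + s + 1) * l.length := by
    intro l
    induction l with
    | nil => simp
    | cons a l ih =>
      have := length_img_le (t := t) (s := s) a
      simp only [List.flatMap_cons, List.length_append, List.length_cons]
      linarith
  refine ⟨2 * ((t + s + 1) * (t + s + 1)), fun z hz hK => ?_⟩
  by_contra hcon
  push Not at hcon
  obtain ⟨l, hl, hzl⟩ := exists_infix_flatMap ht hm hz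
  obtain ⟨l', -, hll⟩ := exists_infix_flatMap ht hm hl
  obtain ⟨x, y, hxy⟩ := hzl.trans (List.IsInfix.flatMap hll (img t s))
  rw [List.flatMap_assoc] at hxy
  have := length_le_of_flatMap (fun b : Fin m => b ≠ 0)
    (fun k => (img t s k).flatMap (img t s)) ((t + s + 1) * (t + s + 1))
    (fun a => (hlen _).trans (Nat.mul_le_mul_left _ (length_img_le a)))
    (fun a => ⟨⟨1, hm⟩, List.mem_flatMap.2 ⟨0, h0 a, h1⟩, by simp [Fin.ext_iff]⟩)
    l' x z y (fun b hb => by simpa using hcon b hb) hxy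
  omega

/-- Every palindrome delimited by a non-zero letter is the image of a palindrome. -/
theorem exists_desubstitution (ht : 0 < t) (hs : 0 < s) (hm : 1 < m) {c : Option (Fin m)}
    {r x : List (Fin m)} {a : Fin m} (ha : a ≠ 0) (h : palOf c (r ++ a :: x) ∈ factors m t s) :
    ∃ c' q, palOf c' q ∈ factors m t s ∧ c = nextCenter t s c' ∧
      r = List.replicate (zeroRun t s c') 0 ++ q.flatMap (conjImg t s) := by
  obtain ⟨l, hl, A, B, hAB⟩ := exists_infix_flatMap ht hm h
  obtain ⟨l₁, l₂, rfl, -, h2⟩ := exists_split l (A ++ x.reverse) (palOf c r ++ [a] ++ (x ++ B)) a ha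
    (by rw [← hAB]; simp [palOf])
  obtain ⟨l₃, l₄, rfl, h3, -⟩ := exists_split l₂ _ _ a ha h2
  rcases List.eq_nil_or_concat' l₃ with rfl | ⟨q, k, rfl⟩
  · simp at h3
  have hq : q.flatMap (img t s) ++ List.replicate t 0 = palOf c r := by
    simp only [List.flatMap_append, List.flatMap_cons, List.flatMap_nil,
      List.append_nil] at h3
    -- The block of `k` ends in `a ≠ 0`, so it is 0^t a; removing `a` leaves φ(q)0^t.
    have hk : (k : ℕ) + 1 < m := by
      by_contra hk
      have := congrArg List.getLast? h3
      obtain ⟨s, rfl⟩ : ∃ r, s = r + 1 := ⟨s - 1, by omega⟩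
      simp [img, hk, List.replicate_succ'] at this
      exact ha this.symm
    rw [img, dif_pos hk, ← List.append_assoc] at h3
    exact (List.append_inj' h3 rfl).1
  have hpal : q.reverse = q := by
    refine flatMap_img_injective (t := t) hs ?_
    refine List.append_cancel_right (bs := List.replicate t 0) ?_
    rw [← reverse_flatMap_img_append, hq, reverse_palOf]
  obtain ⟨c', r', rfl⟩ := exists_palOf q hpal
  rw [palOf_image] at hq
  obtain ⟨h5, h6⟩ := palOf_injective hq
  exact ⟨c', r', factors_of_infix ⟨l₁, [k] ++ l₄, by simp⟩ hl, h5.symm, h6.symm⟩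

/-- Long palindromes come from long palindromes. -/
theorem exists_long_desubstitution (ht : 0 < t) (hs : 0 < s) (hm : 1 < m) (N : ℕ) :
    ∃ N', ∀ (c : Option (Fin m)) (r : List (Fin m)), N' ≤ r.length →
      palOf c r ∈ factors m t s → ∃ c' q, N ≤ q.length ∧ palOf c' q ∈ factors m t s ∧
        c = nextCenter t s c' ∧
        List.replicate (zeroRun t s c') 0 ++ q.flatMap (conjImg t s) <+: r := by
  obtain ⟨K, hK⟩ := exists_zero_bound m t s ht hs hm
  -- The last `K + 1` letters of `r` contain a non-zero letter. Before it stand at most `t + s`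
  -- central zeros and then the image of `q`, with at most `t + s + 1` letters per letter of `q`.
  refine ⟨(t + s + 1) * N + (t + s) + K + 1, fun c r hr hp => ?_⟩
  have hy : r.drop (r.length - (K + 1)) ∈ factors m t s :=
    factors_of_infix ((List.drop_suffix _ _).isInfix.trans ⟨_, [], List.append_nil _⟩) hp
  obtain ⟨a, hay, ha⟩ := hK _ hy (by rw [List.length_drop]; omega)
  obtain ⟨y₁, y₂, hy12⟩ := List.append_of_mem hay
  have hsplit : r = (r.take (r.length - (K + 1)) ++ y₁) ++ a :: y₂ := by
    rw [List.append_assoc, ← hy12, List.take_append_drop]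
  obtain ⟨c', q, hq, hc, hρ⟩ := exists_desubstitution ht hs hm ha (hsplit ▸ hp)
  refine ⟨c', q, ?_, hq, hc, ⟨a :: y₂, by rw [← hρ, ← hsplit]⟩⟩
  have hlen := congrArg List.length hρ
  have h1 := length_flatMap_conjImg_le (t := t) (s := s) q
  have h2 : zeroRun t s c' ≤ t + s := by
    unfold zeroRun; split <;> [skip; split] <;> omega
  simp only [List.length_append, List.length_take, List.length_replicate] at hlen
  by_contra hlt
  have h6 : (t + s + 1) * (q.length + 1) ≤ (t + s + 1) * N := Nat.mul_le_mul_left _ (by omega)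
  rw [Nat.mul_add] at h6
  omega

/-! ### Centers of long palindromes and agreement near the center. -/

/-- There are palindromic factors with center `c` and right half of length at least `N`. -/
def HasLong (t s N : ℕ) (c : Option (Fin m)) : Prop :=
  ∃ r : List (Fin m), N ≤ r.length ∧ palOf c r ∈ factors m t s

/-- On the centers of arbitrarily long palindromes, `nextCenter` is onto, hence injective. -/
theorem exists_nextCenter_injective (ht : 0 < t) (hs : 0 < s) (hm : 1 < m) :
    ∃ N, ∀ c d : Option (Fin m), HasLong t s N c → HasLong t s N d →
      nextCenter t s c = nextCenter t s d → c = d := by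
  classical
  let S : Finset (Option (Fin m)) := Finset.univ.filter fun c => ∀ N, HasLong t s N c
  obtain ⟨N, hN⟩ : ∃ N, ∀ c : Option (Fin m), HasLong t s N c → c ∈ S := by
    have : ∀ c : Option (Fin m), ∃ N, HasLong t s N c → c ∈ S := by
      intro c
      by_cases hc : c ∈ S
      · exact ⟨0, fun _ => hc⟩
      · have : ∃ N, ¬ HasLong t s N c := by simpa [S] using hc
        obtain ⟨N, hN⟩ := this
        exact ⟨N, fun h => absurd h hN⟩
    choose f hf using this
    refine ⟨Finset.univ.sup f, fun c ⟨r, hr, hp⟩ => hf c ⟨r, ?_, hp⟩⟩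
    exact (Finset.le_sup (Finset.mem_univ c)).trans hr
  have hsub : S ⊆ S.image (nextCenter t s) := by
    intro c hc
    obtain ⟨N', hN'⟩ := exists_long_desubstitution ht hs hm N
    obtain ⟨r, hr, hp⟩ := (Finset.mem_filter.1 hc).2 N'
    obtain ⟨c', q, hq, hqp, hcc, -⟩ := hN' c r hr hp
    exact Finset.mem_image.2 ⟨c', hN c' ⟨q, hq, hqp⟩, hcc.symm⟩
  have hinj : Set.InjOn (nextCenter t s) (S : Set (Option (Fin m))) :=
    Finset.card_image_iff.1 (le_antisymm Finset.card_image_le (Finset.card_le_card hsub))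
  exact ⟨N, fun c d hc hd h => hinj (hN c hc) (hN d hd) h⟩

/-- Palindromes with center `c` whose right halves have length at least `N` agree on the first `n`
letters of the right halves. -/
def Agree (t s N n : ℕ) (c : Option (Fin m)) : Prop :=
  ∀ r q : List (Fin m), N ≤ r.length → N ≤ q.length → palOf c r ∈ factors m t s →
    palOf c q ∈ factors m t s → r.take n = q.take n

theorem Agree.mono {N N' n : ℕ} {c : Option (Fin m)} (hN : N ≤ N') (h : Agree t s N n c) :
    Agree t s N' n c :=
  fun r q hr hq => h r q (hN.trans hr) (hN.trans hq)

/-- As `conjImg` erases no letter, `z` zeros and the images of `n - z` letters cover the first `n`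
letters. -/
theorem take_image_eq (hs : 0 < s) {p q : List (Fin m)} {z n : ℕ} (hp : n ≤ p.length)
    (hpq : p.take (n - z) = q.take (n - z)) {r u : List (Fin m)}
    (hr : List.replicate z 0 ++ p.flatMap (conjImg t s) <+: r)
    (hu : List.replicate z 0 ++ q.flatMap (conjImg t s) <+: u) : r.take n = u.take n := by
  have aux : ∀ p r : List (Fin m), List.replicate z 0 ++ p.flatMap (conjImg t s) <+: r →
      List.replicate z 0 ++ (p.take (n - z)).flatMap (conjImg t s) <+: r := by
    intro p r h
    refine List.IsPrefix.trans ?_ h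
    rw [List.prefix_append_right_inj]
    conv_rhs => rw [← List.take_append_drop (n - z) p, List.flatMap_append]
    exact List.prefix_append _ _
  have h1 := aux p r hr
  have h2 := aux q u hu
  rw [← hpq] at h2
  have hlen : n ≤ (List.replicate z 0 ++ (p.take (n - z)).flatMap (conjImg t s)).length := by
    have := length_le_flatMap_conjImg (t := t) hs (p.take (n - z))
    simp only [List.length_append, List.length_replicate, List.length_take] at this ⊢
    omega
  obtain ⟨x, rfl⟩ := h1
  obtain ⟨y, rfl⟩ := h2
  rw [List.take_append_of_le_length hlen, List.take_append_of_le_length hlen]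

theorem exists_agree_of_preimages (ht : 0 < t) (hs : 0 < s) (hm : 1 < m) (N n : ℕ) :
    ∃ N', ∀ c : Option (Fin m),
      (∀ c', nextCenter t s c' = c → Agree t s N (n - zeroRun t s c') c') →
        Agree t s N' n c := by
  obtain ⟨M, hM⟩ := exists_nextCenter_injective (m := m) ht hs hm
  obtain ⟨N', hN'⟩ := exists_long_desubstitution (m := m) ht hs hm (max (max N M) n)
  refine ⟨N', fun c hc r q hr hq hpr hpq => ?_⟩
  obtain ⟨c₁, x, hx, hxf, h1, hxr⟩ := hN' c r hr hpr
  obtain ⟨c₂, y, hy, hyf, h2, hyq⟩ := hN' c q hq hpq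
  simp only [max_le_iff] at hx hy
  obtain rfl : c₁ = c₂ := hM _ _ ⟨x, hx.1.2, hxf⟩ ⟨y, hy.1.2, hyf⟩ (h1.symm.trans h2)
  exact take_image_eq hs hx.2 (hc c₁ h1.symm x y hx.1.1 hy.1.1 hxf hyf) hxr hyq

theorem Agree.anti {N n n' : ℕ} {c : Option (Fin m)} (hn : n' ≤ n) (h : Agree t s N n c) :
    Agree t s N n' c := by
  intro r q hr hq hpr hpq
  have := congrArg (List.take n') (h r q hr hq hpr hpq)
  simpa [List.take_take, hn] using this

theorem exists_agree (ht : 0 < t) (hs : 0 < s) (hm : 1 < m) (n : ℕ) :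
    ∃ N, ∀ c : Option (Fin m), Agree t s N n c := by
  induction n with
  | zero => exact ⟨0, fun c r q _ _ _ _ => by simp⟩
  | succ n ih =>
    obtain ⟨N, hN⟩ := ih
    obtain ⟨N₁, hN₁⟩ := exists_agree_of_preimages (m := m) ht hs hm N (n + 1)
    have hsome : ∀ k : Fin m, Agree t s N (n + 1 - zeroRun t s (some k)) (some k) := fun k =>
      (hN _).anti (by have := zeroRun_some_pos ht hs k; omega)
    have hnone : Agree t s N₁ (n + 1) (none : Option (Fin m)) := by
      refine hN₁ none fun c' hc' => ?_
      cases c' with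
      | some k => exact hsome k
      | none =>
        -- An empty center with empty preimage forces `t` even, so `t / 2 ≥ 1` and the induction
        -- hypothesis suffices.
        have : t % 2 = 0 := by
          by_contra h
          simp [nextCenter, h] at hc'
        exact (hN _).anti (by simp only [zeroRun]; omega)
    -- For other centers a preimage with empty center may contribute no zeros; it uses `hnone`,
    -- already known for `n + 1`.
    obtain ⟨N₂, hN₂⟩ := exists_agree_of_preimages (m := m) ht hs hm (max N N₁) (n + 1)
    refine ⟨N₂, fun c => hN₂ c fun c' _ => ?_⟩
    cases c' with
    | some k => exact (hsome k).mono (le_max_left _ _)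
    | none => exact (hnone.mono (le_max_right _ _)).anti (Nat.sub_le _ _)

end Factors

/-! ### Infinite palindromic branches. -/

section Branches

variable {β : ℝ} {m : ℕ} [NeZero m]

theorem subst_eq_flatMap_img (hC : ConditionC β m) :
    subst β m = fun w => w.flatMap (img (digit β 0) (digit β (m - 1))) := by
  have : substLetter β m = img (digit β 0) (digit β (m - 1)) := by
    funext k
    by_cases hk : (k : ℕ) + 1 < m
    · simp [substLetter, img, hk, hC k hk]
    · have : (k : ℕ) = m - 1 := by have := k.2; omega
      rw [substLetter, img, dif_neg hk, dif_neg hk, this, List.append_nil]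
  funext w
  rw [subst, this]

theorem language_subset_factors (hβ : IsSimpleParry β m) (hC : ConditionC β m) :
    language (uWord β m) ⊆ factors m (digit β 0) (digit β (m - 1)) := by
  rintro w ⟨i, hw⟩
  refine ⟨i + w.length, ?_⟩
  rw [← subst_eq_flatMap_img hC]
  have : w = (((subst β m)^[i + w.length] [0]).drop i).take w.length := by
    refine List.ext_getElem? fun j => ?_
    rw [List.getElem?_take]
    split
    · next hj =>
      rw [List.getElem?_drop, uWord_spec hβ (i + j) (i + w.length) (by omega)]
      conv_lhs => rw [hw]
      simp [hj]
    · next hj => exact List.getElem?_eq_none (by omega)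
  conv_lhs => rw [this]
  exact (List.take_prefix _ _).isInfix.trans (List.drop_suffix _ _).isInfix

theorem branch_half_unique (hβ : IsSimpleParry β m) (hC : ConditionC β m) (hm : 1 < m)
    {c : Option (Fin m)} {v w : ℕ → Fin m} (hv : ∀ n, 1 ≤ n → centralWord c v n ∈ pal (uWord β m))
    (hw : ∀ n, 1 ≤ n → centralWord c w n ∈ pal (uWord β m)) : v = w := by
  funext i
  obtain ⟨N, hN⟩ := exists_agree (m := m) (digit_zero_pos hβ.one_lt)
    (Nat.pos_of_ne_zero hβ.last_ne_zero) hm (i + 1)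
  have h := hN c ((List.range (N + i + 1)).map v) ((List.range (N + i + 1)).map w)
    (by simp; omega) (by simp; omega)
    (language_subset_factors hβ hC (hv _ (by omega)).1)
    (language_subset_factors hβ hC (hw _ (by omega)).1)
  have h' := congrArg (fun l => l[i]?) h
  have hi : i < N + i + 1 := by omega
  simpa [List.getElem?_take, hi] using h'

end Branches

end ParryWord

theorem mainTheorem10 (β : ℝ) (m : ℕ) [NeZero m] (hβ : ParryWord.IsSimpleParry β m)
    (hC : ParryWord.ConditionC β m) (c : Option (Fin m)) :
    {x : ℤ → Fin m |
      ParryWord.IsInfinitePalindromicBranch (ParryWord.uWord β m) c x}.Subsingleton := by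
  rintro x ⟨v, rfl, hv⟩ y ⟨w, rfl, hw⟩
  by_cases hm : 1 < m
  · rw [ParryWord.branch_half_unique hβ hC hm hv hw]
  · obtain rfl : m = 1 := by have := hβ.pos; omega
    exact Subsingleton.elim _ _
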